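/- Let $(X,\omega)$ be a closed translation surface: a compact connected surface $X$ with a nonzero holomorphic $1$-form $\omega$, equivalently a finite set of zeros, an atlas on their complement whose coordinate changes are translations, and, near each zero of order $k\ge 1$, a coordinate $z$ with $\omega=d(z^{k+1})$. Let $\phi^t$ be the unit-speed vertical flow, which is defined as long as the orbit does not hit a zero, and assume that it is minimal: every vertical line that hits no zero in either direction is dense in $X$. A Borel probability measure $\mu$ on $X$ is invariant if $\mu$-almost every point has an orbit defined for all times and $\phi^t$ preserves $\mu$. A point $p$ whose orbit is defined for all times is a ($2$-sided) generic point of $\mu$ if for all continuous $f:X\to\mathbb R$ $$\lim_{S,T\to\infty}\frac1{S+T}\int_{-S}^{T}f(\phi^t(p))\,dt=\int_X f\,d\mu .$$ For $t\in\mathbb R$ let $g_t(X,\omega)$ be the translation surface obtained by post-composing the translation charts of $(X,\omega)$ with $\begin{pmatrix}e^{t/2}&0\\0&e^{-t/2}\end{pmatrix}$, and let $g_t$ also denote the resulting map from $(X,\omega)$ to $g_t(X,\omega)$ (the identity on points of $X$). Given $0<\eta\le 1$, two vertical segments $\beta,\beta'$ of the same length $|\beta|=|\beta'|>0$ on a translation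 surface $\eta$-interact if there are subsegments of $\beta$ and $\beta'$ of length at least $\eta|\beta|$ that are the two vertical sides of an isometrically embedded rectangle. Let $\mu\ne\mu'$ be invariant Borel probability measures with generic points $p$ and $p'$ respectively. Let $t_n\to\infty$, and for each $n$ let $\beta(t_n),\beta'(t_n)$ be vertical segments of $g_{t_n}(X,\omega)$ of equal length, containing $g_{t_n}(p)$ and $g_{t_n}(p')$ respectively (as an endpoint or in the interior), such that $$e^{t_n/2}|\beta(t_n)|\to\infty .$$ If $0<\eta(t_n)\le 1$ and $\beta(t_n),\beta'(t_n)$ $\eta(t_n)$-interact for every $n$, then $\lim_{n\to\infty}\eta(t_n)=0$. -/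

import Mathlib

open Filter Topology MeasureTheory

/-- A translation surface structure on a topological space `X` (for a closed surface: `X` compact,
connected and Hausdorff): finitely many zeros, an atlas of `ℂ`-valued charts on the complement of
the zeros whose coordinate changes are locally translations (so that `dz` is a global `1`-form `ω`),
and, around each zero, a coordinate `φ` in which `ω = d(φ ^ (k + 1))`, where `k ≥ 1` is the order
of the zero (cone angle `2π(k + 1)`). -/
structure TranslationSurface (X : Type*) [TopologicalSpace X] where
  zeros : Set X
  finite_zeros : zeros.Finite
  atlas : Set (OpenPartialHomeomorph X ℂ)
  disjoint_zeros : ∀ e ∈ atlas, Disjoint e.source zeros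
  covers : ∀ x, x ∉ zeros → ∃ e ∈ atlas, x ∈ e.source
  translation : ∀ e ∈ atlas, ∀ e' ∈ atlas, ∀ x ∈ e.source ∩ e'.source,
    ∀ᶠ y in 𝓝 x, e' y - e' x = e y - e x
  cone : ∀ σ ∈ zeros, ∃ k : ℕ, 1 ≤ k ∧ ∃ φ : OpenPartialHomeomorph X ℂ,
    σ ∈ φ.source ∧ φ σ = 0 ∧ ∀ e ∈ atlas, ∀ x ∈ e.source ∩ φ.source,
      ∀ᶠ y in 𝓝 x, e y - e x = φ y ^ (k + 1) - φ x ^ (k + 1)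

namespace Teichmuller

/-- The linear map `diag(e^{t/2}, e^{-t/2})` of the plane. -/
noncomputable def lin (t : ℝ) (z : ℂ) : ℂ :=
  ⟨Real.exp (t / 2) * z.re, Real.exp (-t / 2) * z.im⟩

theorem lin_neg_lin (t : ℝ) (z : ℂ) : lin (-t) (lin t z) = z := by
  have h1 : Real.exp (-t / 2) * Real.exp (t / 2) = 1 := by
    rw [← Real.exp_add]; ring_nf; exact Real.exp_zero
  apply Complex.ext
  · simp only [lin]; rw [← mul_assoc, h1, one_mul]
  · simp only [lin, neg_neg]; rw [← mul_assoc, mul_comm (Real.exp _), h1, one_mul]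

theorem lin_lin_neg (t : ℝ) (z : ℂ) : lin t (lin (-t) z) = z := by
  simpa using lin_neg_lin (-t) z

theorem lin_sub (t : ℝ) (z w : ℂ) : lin t (z - w) = lin t z - lin t w := by
  apply Complex.ext <;> simp [lin, mul_sub]

theorem continuous_lin (t : ℝ) : Continuous (lin t) := by
  have : lin t = fun z : ℂ => ((Real.exp (t / 2) * z.re : ℝ) : ℂ) +
      ((Real.exp (-t / 2) * z.im : ℝ) : ℂ) * Complex.I := by
    funext z; apply Complex.ext <;> simp [lin, -Complex.ofReal_mul, -Complex.ofReal_exp]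
  rw [this]; fun_prop

noncomputable def linHomeomorph (t : ℝ) : ℂ ≃ₜ ℂ where
  toFun := lin t
  invFun := lin (-t)
  left_inv := lin_neg_lin t
  right_inv := lin_lin_neg t
  continuous_toFun := continuous_lin t
  continuous_invFun := continuous_lin (-t)

theorem lin_zero (t : ℝ) : lin t 0 = 0 := by
  apply Complex.ext <;> simp [lin]

theorem lin_ne_zero (t : ℝ) {w : ℂ} (hw : w ≠ 0) : lin t w ≠ 0 := by
  intro h
  apply hw
  rw [← lin_neg_lin t w, h, lin_zero]

theorem div_mem_slitPlane (t : ℝ) {w : ℂ} (hw : w ≠ 0) : lin t w / w ∈ Complex.slitPlane := by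
  left
  have h0 : 0 < Complex.normSq w := Complex.normSq_pos.2 hw
  rw [Complex.div_re, ← add_div]
  apply div_pos _ h0
  simp only [lin]
  have hr := Real.exp_pos (t / 2)
  have hi := Real.exp_pos (-t / 2)
  rw [Complex.normSq_apply] at h0
  rcases eq_or_ne w.re 0 with h | h
  · have : w.im ≠ 0 := fun h' => hw (Complex.ext h h')
    have := mul_self_pos.2 this
    nlinarith [mul_self_nonneg w.re, mul_pos hi this, mul_nonneg hr.le (mul_self_nonneg w.re)]
  · have := mul_self_pos.2 h
    nlinarith [mul_self_nonneg w.im, mul_pos hr this, mul_nonneg hi.le (mul_self_nonneg w.im)]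

/-- The lift of the linear map `lin t` under the branched covering `z ↦ z ^ (k + 1)`. -/
noncomputable def lift (k : ℕ) (t : ℝ) (z : ℂ) : ℂ :=
  z * (lin t (z ^ (k + 1)) / z ^ (k + 1)) ^ (((k + 1 : ℕ) : ℂ)⁻¹)

theorem lift_zero (k : ℕ) (t : ℝ) : lift k t 0 = 0 := by simp [lift]

theorem lift_pow (k : ℕ) (t : ℝ) (z : ℂ) : lift k t z ^ (k + 1) = lin t (z ^ (k + 1)) := by
  rcases eq_or_ne z 0 with rfl | hz
  · rw [lift_zero]; simp [lin_zero]
  · rw [lift, mul_pow, Complex.cpow_nat_inv_pow _ (Nat.succ_ne_zero k)]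
    exact mul_div_cancel₀ _ (pow_ne_zero _ hz)

theorem lift_neg_lift (k : ℕ) (t : ℝ) (z : ℂ) : lift k (-t) (lift k t z) = z := by
  rcases eq_or_ne z 0 with rfl | hz
  · rw [lift_zero, lift_zero]
  · have hw : z ^ (k + 1) ≠ 0 := pow_ne_zero _ hz
    have hs := div_mem_slitPlane t hw
    have hu : lin t (z ^ (k + 1)) / z ^ (k + 1) ≠ 0 := div_ne_zero (lin_ne_zero t hw) hw
    rw [lift, lift_pow, lin_neg_lin, ← inv_div (lin t (z ^ (k + 1))),
      Complex.inv_cpow _ _ (Complex.mem_slitPlane_iff_arg.1 hs).1, lift, mul_assoc,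
      mul_inv_cancel₀, mul_one]
    simp [Complex.cpow_eq_zero_iff, hu]

theorem lift_lift_neg (k : ℕ) (t : ℝ) (z : ℂ) : lift k t (lift k (-t) z) = z := by
  simpa using lift_neg_lift k (-t) z

theorem continuous_lift (k : ℕ) (t : ℝ) : Continuous (lift k t) := by
  rw [continuous_iff_continuousAt]
  intro z
  rcases eq_or_ne z 0 with rfl | hz
  · have hpow : ContinuousAt (fun z : ℂ => ‖lin t (z ^ (k + 1))‖) 0 :=
      ((continuous_lin t).comp (continuous_pow (k + 1))).norm.continuousAt
    rw [ContinuousAt, lift_zero, Metric.tendsto_nhds]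
    intro ε hε
    have hl : ∀ᶠ z : ℂ in 𝓝 0, ‖lin t (z ^ (k + 1))‖ < ε ^ (k + 1) := by
      apply hpow.eventually (gt_mem_nhds _)
      simpa [lin_zero] using pow_pos hε (k + 1)
    filter_upwards [hl] with y hy
    rw [dist_zero_right]
    rw [← lift_pow, norm_pow] at hy
    exact lt_of_pow_lt_pow_left₀ _ hε.le hy
  · have hw : z ^ (k + 1) ≠ 0 := pow_ne_zero _ hz
    have h1 : ContinuousAt (fun z : ℂ => lin t (z ^ (k + 1)) / z ^ (k + 1)) z :=
      (((continuous_lin t).comp (continuous_pow (k + 1))).continuousAt).div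
        (continuous_pow (k + 1)).continuousAt hw
    exact continuousAt_id.mul (h1.cpow continuousAt_const (div_mem_slitPlane t hw))

noncomputable def liftHomeomorph (k : ℕ) (t : ℝ) : ℂ ≃ₜ ℂ where
  toFun := lift k t
  invFun := lift k (-t)
  left_inv := lift_neg_lift k t
  right_inv := lift_lift_neg k t
  continuous_toFun := continuous_lift k t
  continuous_invFun := continuous_lift k (-t)

end Teichmuller

namespace TranslationSurface

variable {X : Type*} [TopologicalSpace X]

/-- The Teichmüller geodesic flow: `g_t(X, ω)` is carried by the same space `X`, with every
translation chart post-composed with `diag(e^{t/2}, e^{-t/2})`. The Teichmüller map from `(X, ω)` to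
`g_t(X, ω)`, which is linear in the translation charts, is then the identity of `X`. -/
noncomputable def teichmuller (S : TranslationSurface X) (t : ℝ) : TranslationSurface X where
  zeros := S.zeros
  finite_zeros := S.finite_zeros
  atlas := (fun e => e.transHomeomorph (Teichmuller.linHomeomorph t)) '' S.atlas
  disjoint_zeros := by
    rintro _ ⟨e, he, rfl⟩
    exact S.disjoint_zeros e he
  covers := by
    intro x hx
    obtain ⟨e, he, hxe⟩ := S.covers x hx
    exact ⟨_, ⟨e, he, rfl⟩, hxe⟩
  translation := by
    rintro _ ⟨e, he, rfl⟩ _ ⟨e', he', rfl⟩ x hx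
    filter_upwards [S.translation e he e' he' x hx] with y hy
    change Teichmuller.lin t (e' y) - Teichmuller.lin t (e' x) =
      Teichmuller.lin t (e y) - Teichmuller.lin t (e x)
    rw [← Teichmuller.lin_sub, hy, Teichmuller.lin_sub]
  cone := by
    intro σ hσ
    obtain ⟨k, hk, φ, hφ, h0, h⟩ := S.cone σ hσ
    refine ⟨k, hk, φ.transHomeomorph (Teichmuller.liftHomeomorph k t), hφ, ?_, ?_⟩
    · change Teichmuller.lift k t (φ σ) = 0
      rw [h0, Teichmuller.lift_zero]
    · rintro _ ⟨e, he, rfl⟩ x hx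
      filter_upwards [h e he x hx] with y hy
      change Teichmuller.lin t (e y) - Teichmuller.lin t (e x) =
        Teichmuller.lift k t (φ y) ^ (k + 1) - Teichmuller.lift k t (φ x) ^ (k + 1)
      rw [Teichmuller.lift_pow, Teichmuller.lift_pow, ← Teichmuller.lin_sub,
        ← Teichmuller.lin_sub, hy]

/-- On the set of times `J`, the curve `γ` avoids the zeros and moves vertically upwards with unit
speed. -/
def IsVertical (S : TranslationSurface X) (J : Set ℝ) (γ : ℝ → X) : Prop :=
  ∀ s ∈ J, γ s ∉ S.zeros ∧ ∀ e ∈ S.atlas, γ s ∈ e.source →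
    ∀ᶠ r in 𝓝[J] s, γ r ∈ e.source ∧ e (γ r) = e (γ s) + ((r - s : ℝ) : ℂ) * Complex.I

/-- The complete vertical lines, i.e. those that hit no zero in either direction, are dense. -/
def IsMinimal (S : TranslationSurface X) : Prop :=
  ∀ γ : ℝ → X, S.IsVertical Set.univ γ → Dense (Set.range γ)

/-- `φ^t(x) = y` for the (partially defined) vertical flow `φ` and `t ∈ ℝ`. -/
def FlowsTo (S : TranslationSurface X) (t : ℝ) (x y : X) : Prop :=
  ∃ γ : ℝ → X, S.IsVertical (Set.uIcc 0 t) γ ∧ γ 0 = x ∧ γ t = y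

/-- `μ` is invariant under the vertical flow: almost every point has an orbit defined for all times,
and `μ(φ^{-t}(A)) = μ(A)` for all Borel sets `A` and all `t`. -/
def IsInvariant [MeasurableSpace X] (S : TranslationSurface X) (μ : Measure X) : Prop :=
  (∀ᵐ x ∂μ, ∃ γ : ℝ → X, S.IsVertical Set.univ γ ∧ γ 0 = x) ∧
    ∀ (t : ℝ) (A : Set X), MeasurableSet A → μ {x | ∃ y ∈ A, S.FlowsTo t x y} = μ A

/-- `p` is a 2-sided generic point of `μ` for the vertical flow. -/
def IsGenericPoint [MeasurableSpace X] (S : TranslationSurface X) (μ : Measure X) (p : X) : Prop :=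
  ∃ γ : ℝ → X, S.IsVertical Set.univ γ ∧ γ 0 = p ∧ ∀ f : C(X, ℝ),
    Tendsto (fun q : ℝ × ℝ => (1 / (q.1 + q.2)) * ∫ t in (-q.1)..q.2, f (γ t))
      (atTop ×ˢ atTop) (𝓝 (∫ x, f x ∂μ))

/-- A vertical segment of positive length, parametrized upwards by arc length. -/
structure VerticalSegment (S : TranslationSurface X) where
  length : ℝ
  length_pos : 0 < length
  toFun : ℝ → X
  isVertical : S.IsVertical (Set.Icc 0 length) toFun

/-- The set of points of a vertical segment. -/
def VerticalSegment.carrier {S : TranslationSurface X} (β : S.VerticalSegment) : Set X :=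
  β.toFun '' Set.Icc 0 β.length

/-- `F` is an isometric embedding of the Euclidean rectangle `[0, w] × [0, h]` with horizontal and
vertical sides. Zeros may lie at most on its two horizontal sides. -/
structure IsEmbeddedRectangle (S : TranslationSurface X) (w h : ℝ) (F : ℂ → X) : Prop where
  width_pos : 0 < w
  height_pos : 0 < h
  continuousOn : ContinuousOn F (Set.Icc 0 w ×ℂ Set.Icc 0 h)
  injOn : Set.InjOn F (Set.Icc 0 w ×ℂ Set.Icc 0 h)
  notMem_zeros : ∀ z ∈ Set.Icc 0 w ×ℂ Set.Ioo 0 h, F z ∉ S.zeros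
  translation : ∀ z ∈ Set.Icc 0 w ×ℂ Set.Ioo 0 h, ∀ e ∈ S.atlas, F z ∈ e.source →
    ∀ᶠ z' in 𝓝[Set.Icc 0 w ×ℂ Set.Icc 0 h] z, e (F z') = e (F z) + (z' - z)

/-- The vertical side `{x} × [0, h]` of the rectangle `F` is a subsegment of `β`. -/
def IsSideOf {S : TranslationSurface X} (F : ℂ → X) (x h : ℝ) (β : S.VerticalSegment) : Prop :=
  ∃ a : ℝ, 0 ≤ a ∧ a + h ≤ β.length ∧ ∀ y ∈ Set.Icc 0 h, F ⟨x, y⟩ = β.toFun (a + y)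

/-- The vertical segments `β` and `β'` (of the same length) `η`-interact: they have subsegments of
length at least `η |β|` that are the two vertical sides, in either order, of an isometrically
embedded rectangle. -/
def Interact (S : TranslationSurface X) (η : ℝ) (β β' : S.VerticalSegment) : Prop :=
  β.length = β'.length ∧ ∃ (w h : ℝ) (F : ℂ → X),
    S.IsEmbeddedRectangle w h F ∧ η * β.length ≤ h ∧
      ((IsSideOf F 0 h β ∧ IsSideOf F w h β') ∨ (IsSideOf F 0 h β' ∧ IsSideOf F w h β))

end TranslationSurface

/-! If `η` does not tend to `0`, then `η n ≥ c > 0` for infinitely many `n`. The linear map `lin (t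
n)` pulls the interaction rectangle back to an embedded rectangle of `S` whose height `H` is at
least `c` times `exp (t n / 2) * |β|`, hence arbitrarily large. Its sides lie on the orbits of `p`
and `p'`, starting at times bounded by `H / c`. Genericity then makes the average of `f` over one
side close to `∫ f ∂μ` and over the other close to `∫ f ∂μ'`.

The two averages are also close to each other, because a tall rectangle is thin
(`IsGenericLine.exists_width_le`). In a rectangle of width at least `δ`, the left side can return to
a small chart ball only within bounded time, since otherwise the rectangle would overlap itself. It
would thus spend bounded time in any compact set avoiding the zeros, whereas a generic orbit spends
a positive proportion of its time in a suitable one. Across a thin rectangle, a function vanishing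
at the zeros varies little (`exists_width_abs_sub_le`).

Such functions determine `μ` and `μ'`, as neither measure charges the zeros (`measure_ext`). So `μ =
μ'`, a contradiction. -/

/-! ### Unique continuation of vertical lines and rectangles -/

/-- Two continuous maps on a preconnected set that agree at one point, and agree near every point
of agreement, are equal. -/
theorem eqOn_of_eventuallyEq_of_isPreconnected {α X : Type*} [TopologicalSpace α]
    [TopologicalSpace X] [T2Space X] {J : Set α} (hJ : IsPreconnected J) {f g : α → X}
    (hf : ContinuousOn f J) (hg : ContinuousOn g J) {a : α} (ha : a ∈ J) (hfa : f a = g a)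
    (h : ∀ s ∈ J, f s = g s → ∀ᶠ r in 𝓝[J] s, f r = g r) : Set.EqOn f g J := by
  have : PreconnectedSpace J := Subtype.preconnectedSpace hJ
  have hcl : IsClosed {x : J | f x = g x} :=
    isClosed_eq hf.domRestrict hg.domRestrict
  have hop : IsOpen {x : J | f x = g x} := by
    rw [isOpen_iff_mem_nhds]
    intro x hx
    have := h x x.2 hx
    rw [nhdsWithin_eq_map_subtype_coe x.2] at this
    exact this
  have := IsClopen.eq_univ ⟨hcl, hop⟩ ⟨⟨a, ha⟩, hfa⟩
  intro x hx
  have hx' : (⟨x, hx⟩ : J) ∈ {x : J | f x = g x} := this ▸ Set.mem_univ _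
  exact hx'

namespace TranslationSurface

variable {X : Type*} [TopologicalSpace X]

theorem IsVertical.continuousOn {S : TranslationSurface X} {J : Set ℝ} {γ : ℝ → X}
    (h : S.IsVertical J γ) : ContinuousOn γ J := by
  intro s hs
  obtain ⟨hz, h⟩ := h s hs
  obtain ⟨e, he, hes⟩ := S.covers _ hz
  have h := h e he hes
  have hlim : Tendsto (fun r : ℝ => e (γ s) + ((r - s : ℝ) : ℂ) * Complex.I) (𝓝[J] s)
      (𝓝 (e (γ s))) := by
    have hc : Continuous fun r : ℝ => e (γ s) + ((r - s : ℝ) : ℂ) * Complex.I := by fun_prop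
    simpa using (hc.tendsto s).mono_left nhdsWithin_le_nhds
  have := (e.tendsto_symm hes).comp hlim
  refine this.congr' ?_
  filter_upwards [h] with r hr
  rw [Function.comp, ← hr.2, e.left_inv hr.1]

/-- Both curves have the same expression in a chart around a common point. This identifies a segment
through a generic point with a piece of its orbit. -/
theorem IsVertical.eqOn [T2Space X] {S : TranslationSurface X} {J : Set ℝ} (hJ : IsPreconnected J)
    {γ γ' : ℝ → X} (h : S.IsVertical J γ) (h' : S.IsVertical J γ') {a : ℝ} (ha : a ∈ J)
    (haa : γ a = γ' a) : Set.EqOn γ γ' J := by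
  refine eqOn_of_eventuallyEq_of_isPreconnected hJ h.continuousOn h'.continuousOn ha haa ?_
  intro s hs hss
  obtain ⟨e, he, hes⟩ := S.covers _ (h s hs).1
  filter_upwards [(h s hs).2 e he hes, (h' s hs).2 e he (hss ▸ hes)] with r h1 h2
  apply e.injOn h1.1 h2.1
  rw [h1.2, h2.2, hss]

theorem IsVertical.mono {S : TranslationSurface X} {J J' : Set ℝ} {γ : ℝ → X}
    (h : S.IsVertical J γ) (hJ : J' ⊆ J) : S.IsVertical J' γ := fun s hs =>
  ⟨(h s (hJ hs)).1, fun e he hes =>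
    ((h s (hJ hs)).2 e he hes).filter_mono (nhdsWithin_mono s hJ)⟩

/-- Developing an embedded rectangle along a straight segment inside a translation chart. -/
theorem IsEmbeddedRectangle.apply_eq_of_segment [T2Space X] {S : TranslationSurface X} {w h : ℝ}
    {F : ℂ → X} (hF : S.IsEmbeddedRectangle w h F) {z v : ℂ}
    (hz : z ∈ Set.Icc 0 w ×ℂ Set.Ioo 0 h) (hzv : z + v ∈ Set.Icc 0 w ×ℂ Set.Ioo 0 h)
    {e : OpenPartialHomeomorph X ℂ} (he : e ∈ S.atlas) (hze : F z ∈ e.source)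
    (ht : ∀ τ ∈ Set.Icc (0 : ℝ) 1, e (F z) + τ * v ∈ e.target) :
    F (z + v) = e.symm (e (F z) + v) := by
  have hmem : ∀ τ ∈ Set.Icc (0 : ℝ) 1, z + τ * v ∈ Set.Icc 0 w ×ℂ Set.Ioo 0 h := by
    intro τ hτ
    have hc : Convex ℝ (Set.Icc 0 w ×ℂ Set.Ioo 0 h) :=
      ((convex_Icc (0 : ℝ) w).linear_preimage Complex.reLm).inter
        ((convex_Ioo (0 : ℝ) h).linear_preimage Complex.imLm)
    have := hc.add_smul_mem hz hzv hτ
    simpa using this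
  have hsub : Set.Icc 0 w ×ℂ Set.Ioo 0 h ⊆ Set.Icc 0 w ×ℂ Set.Icc 0 h := fun z hz =>
    ⟨hz.1, Set.Ioo_subset_Icc_self hz.2⟩
  have hp : Continuous fun τ : ℝ => z + τ * v := by fun_prop
  have hmaps : Set.MapsTo (fun τ : ℝ => z + τ * v) (Set.Icc 0 1) (Set.Icc 0 w ×ℂ Set.Icc 0 h) :=
    fun τ hτ => hsub (hmem τ hτ)
  have h1 : ContinuousOn (fun τ : ℝ => F (z + τ * v)) (Set.Icc 0 1) :=
    hF.continuousOn.comp hp.continuousOn hmaps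
  have h2 : ContinuousOn (fun τ : ℝ => e.symm (e (F z) + τ * v)) (Set.Icc 0 1) :=
    e.continuousOn_symm.comp (by fun_prop) ht
  -- Unique continuation in `τ`: near a point of agreement, both curves read in `e` are the same
  -- affine path.
  have key := eqOn_of_eventuallyEq_of_isPreconnected isPreconnected_Icc h1 h2 (a := 0) (by simp)
    (by simp [e.left_inv hze]) ?_
  · simpa using key (show (1 : ℝ) ∈ Set.Icc (0 : ℝ) 1 by simp)
  intro s hs hss
  have hs1 : F (z + s * v) ∈ e.source := by
    have := e.map_target (ht s hs)
    rwa [← hss] at this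
  have hs2 : e (F (z + s * v)) = e (F z) + s * v := by
    rw [hss, e.right_inv (ht s hs)]
  have hsrc := (h1 s hs).eventually (e.open_source.mem_nhds hs1)
  have htr := (tendsto_nhdsWithin_iff.2 ⟨hp.continuousWithinAt (s := Set.Icc 0 1) (x := s),
    eventually_mem_nhdsWithin.mono hmaps⟩).eventually (hF.translation _ (hmem s hs) e he hs1)
  filter_upwards [hsrc, htr] with r hr1 hr2
  rw [← e.left_inv hr1, hr2, hs2]
  congr 1
  ring

end TranslationSurface

/-! ### Averages along a generic line -/

/-- If the averages of `u` over `[-S, T]` converge to `m` as `S, T → ∞`, then the primitive of `u`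
is `x * m + o(x)` at `± ∞`. -/
theorem exists_abs_integral_sub_le_of_tendsto_average {u : ℝ → ℝ} (hu : Continuous u) {m : ℝ}
    (h : Tendsto (fun q : ℝ × ℝ => (1 / (q.1 + q.2)) * ∫ t in (-q.1)..q.2, u t)
      (atTop ×ˢ atTop) (𝓝 m)) {ε : ℝ} (hε : 0 < ε) :
    ∃ C, ∀ x : ℝ, |(∫ t in (0 : ℝ)..x, u t) - x * m| ≤ ε * |x| + C := by
  set G : ℝ → ℝ := fun x => (∫ t in (0 : ℝ)..x, u t) - x * m with hG
  have hi : ∀ a b, IntervalIntegrable u volume a b := fun a b => hu.intervalIntegrable a b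
  have hGc : Continuous G :=
    (intervalIntegral.continuous_primitive hi 0).sub (continuous_id.mul continuous_const)
  rw [prod_atTop_atTop_eq] at h
  obtain ⟨⟨S₀, T₀⟩, hA⟩ := eventually_atTop.1 (h.eventually (Metric.ball_mem_nhds m hε))
  obtain ⟨A, hA0, hAS, hAT⟩ : ∃ A : ℝ, 1 ≤ A ∧ S₀ ≤ A ∧ T₀ ≤ A :=
    ⟨max 1 (max S₀ T₀), by simp, by simp, by simp⟩
  -- The hypothesis only controls increments of `G` across the origin; freezing one endpoint at `A`
  -- or `-A` bounds `G` at the other.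
  have key : ∀ S T : ℝ, A ≤ S → A ≤ T → |G T - G (-S)| ≤ ε * (S + T) := by
    intro S T hS hT
    have hp : 0 < S + T := by linarith
    have h1 := hA (S, T) ⟨hAS.trans hS, hAT.trans hT⟩
    rw [Real.dist_eq] at h1
    have h2 : G T - G (-S) = (S + T) * (1 / (S + T) * (∫ t in (-S)..T, u t) - m) := by
      have := intervalIntegral.integral_interval_sub_left (hi 0 T) (hi 0 (-S))
      rw [← this]
      simp only [hG]
      field_simp
      ring
    rw [h2, abs_mul, abs_of_pos hp, mul_comm ε]
    gcongr
  obtain ⟨B, hB⟩ := (isCompact_Icc (a := -A) (b := A)).exists_bound_of_continuousOn hGc.continuousOn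
  refine ⟨ε * A + |G (-A)| + |G A| + |B|, fun x => ?_⟩
  change |G x| ≤ _
  have hεA : 0 ≤ ε * A := by positivity
  rcases le_total A x with hx | hx
  · have h1 := key A x le_rfl hx
    have h2 := abs_sub_abs_le_abs_sub (G x) (G (-A))
    rw [abs_of_nonneg (by linarith : 0 ≤ x)]
    linarith [abs_nonneg (G A), abs_nonneg B]
  rcases le_total x (-A) with hx' | hx'
  · have h1 := key (-x) A (by linarith) le_rfl
    rw [neg_neg, abs_sub_comm] at h1
    have h2 := abs_sub_abs_le_abs_sub (G x) (G A)
    rw [abs_of_nonpos (by linarith : x ≤ 0)]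
    linarith [abs_nonneg (G (-A)), abs_nonneg B]
  · have h1 := hB x ⟨hx', hx⟩
    rw [Real.norm_eq_abs] at h1
    have : 0 ≤ ε * |x| := by positivity
    linarith [abs_nonneg (G (-A)), abs_nonneg (G A), le_abs_self B]

/-- Averages over windows `[a, a + H]` with `|a| = O(H)` converge as `H → ∞`. -/
theorem exists_abs_integral_window_sub_le {u : ℝ → ℝ} (hu : Continuous u) {m : ℝ}
    (h : Tendsto (fun q : ℝ × ℝ => (1 / (q.1 + q.2)) * ∫ t in (-q.1)..q.2, u t)
      (atTop ×ˢ atTop) (𝓝 m)) {ε M : ℝ} (hε : 0 < ε) (hM : 0 ≤ M) :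
    ∃ R, ∀ H a : ℝ, R ≤ H → |a| ≤ M * H →
      |(∫ y in (0 : ℝ)..H, u (a + y)) - H * m| ≤ ε * H := by
  have hi : ∀ a b, IntervalIntegrable u volume a b := fun a b => hu.intervalIntegrable a b
  -- Since `|a| + |a + H| ≤ (2 * M + 1) * H`, the linear errors at the two ends total at most `ε * H
  -- / 2`; the two constants `C` are absorbed by `H ≥ 4 * C / ε`.
  have hε' : 0 < ε / (2 * (2 * M + 1)) := by positivity
  obtain ⟨C, hC⟩ := exists_abs_integral_sub_le_of_tendsto_average hu h hε'
  refine ⟨max 0 (4 * C / ε), fun H a hH ha => ?_⟩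
  have hH0 : 0 ≤ H := (le_max_left _ _).trans hH
  have hHC : 4 * C ≤ H * ε := (div_le_iff₀ hε).1 ((le_max_right _ _).trans hH)
  have h1 := hC (a + H)
  have h2 := hC a
  have h3 : (∫ y in (0 : ℝ)..H, u (a + y)) - H * m =
      ((∫ t in (0 : ℝ)..(a + H), u t) - (a + H) * m) - ((∫ t in (0 : ℝ)..a, u t) - a * m) := by
    rw [intervalIntegral.integral_comp_add_left, add_zero,
      ← intervalIntegral.integral_interval_sub_left (hi 0 (a + H)) (hi 0 a)]
    ring
  have h4 : |a + H| ≤ M * H + H := (abs_add_le a H).trans (by rw [abs_of_nonneg hH0]; linarith)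
  have h5 : ε / (2 * (2 * M + 1)) * (M * H + H + M * H) = ε * H / 2 := by field_simp; ring
  rw [h3]
  refine (abs_sub _ _).trans ?_
  have h6 : ε / (2 * (2 * M + 1)) * |a + H| + ε / (2 * (2 * M + 1)) * |a| ≤ ε * H / 2 := by
    rw [← h5, ← mul_add]; gcongr
  linarith

/-! ### Thin and wide embedded rectangles -/

namespace TranslationSurface

variable {X : Type*} [TopologicalSpace X]

theorem IsEmbeddedRectangle.apply_eq_of_mem_ball [T2Space X] {S : TranslationSurface X} {w h : ℝ}
    {F : ℂ → X} (hF : S.IsEmbeddedRectangle w h F) {z z' : ℂ}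
    (hz : z ∈ Set.Icc 0 w ×ℂ Set.Ioo 0 h) (hz' : z' ∈ Set.Icc 0 w ×ℂ Set.Ioo 0 h)
    {e : OpenPartialHomeomorph X ℂ} (he : e ∈ S.atlas) (hze : F z ∈ e.source)
    {c : ℂ} {r : ℝ} (hr : Metric.ball c r ⊆ e.target) (h0 : e (F z) ∈ Metric.ball c r)
    (h1 : e (F z) + (z' - z) ∈ Metric.ball c r) :
    F z' = e.symm (e (F z) + (z' - z)) := by
  have h := hF.apply_eq_of_segment hz (v := z' - z) (by rwa [add_sub_cancel]) he hze ?_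
  · rwa [add_sub_cancel] at h
  intro τ hτ
  have := (convex_ball c r).add_smul_mem h0 h1 hτ
  exact hr (by simpa using this)

theorem exists_ball_subset_target (S : TranslationSurface X) {x : X} (hx : x ∉ S.zeros)
    {V : Set X} (hV : V ∈ 𝓝 x) {δ : ℝ} (hδ : 0 < δ) :
    ∃ e ∈ S.atlas, x ∈ e.source ∧ ∃ r, 0 < r ∧ r ≤ δ ∧ Metric.ball (e x) r ⊆ e.target ∧
      ∀ z ∈ Metric.ball (e x) r, e.symm z ∈ V := by
  obtain ⟨e, he, hxe⟩ := S.covers x hx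
  have h1 : e.symm ⁻¹' V ∈ 𝓝 (e x) := e.tendsto_symm hxe hV
  obtain ⟨r, hr, hrs⟩ := Metric.mem_nhds_iff.1
    (inter_mem (e.open_target.mem_nhds (e.map_source hxe)) h1)
  refine ⟨e, he, hxe, min r δ, lt_min hr hδ, min_le_right _ _, fun z hz => ?_, fun z hz => ?_⟩
  · exact (hrs (Metric.ball_subset_ball (min_le_left _ _) hz)).1
  · exact (hrs (Metric.ball_subset_ball (min_le_left _ _) hz)).2

theorem preimage_ball_mem_nhds {e : OpenPartialHomeomorph X ℂ} {x : X} (hx : x ∈ e.source)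
    {r : ℝ} (hr : 0 < r) : e.source ∩ e ⁻¹' Metric.ball (e x) r ∈ 𝓝 x :=
  inter_mem (e.open_source.mem_nhds hx)
    ((e.continuousAt hx).preimage_mem_nhds (Metric.ball_mem_nhds _ hr))

/-- The vertical sides of thin rectangles are uniformly close away from the zeros. -/
theorem exists_width_abs_sub_le_of_mem [T2Space X] (S : TranslationSurface X) (f : C(X, ℝ))
    {ε : ℝ} (hε : 0 < ε) {K : Set X} (hK : IsCompact K) (hKz : ∀ x ∈ K, x ∉ S.zeros) :
    ∃ δ > 0, ∀ (w h : ℝ) (F : ℂ → X), S.IsEmbeddedRectangle w h F → w ≤ δ → ∀ y ∈ Set.Ioo 0 h,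
      (F ⟨0, y⟩ ∈ K ∨ F ⟨w, y⟩ ∈ K) → |f (F ⟨0, y⟩) - f (F ⟨w, y⟩)| ≤ ε := by
  -- The property passes to subsets and finite unions, so compactness reduces it to a neighbourhood
  -- of each point.
  refine hK.induction_on (p := fun K => ∃ δ > 0, ∀ (w h : ℝ) (F : ℂ → X),
    S.IsEmbeddedRectangle w h F → w ≤ δ → ∀ y ∈ Set.Ioo 0 h,
      (F ⟨0, y⟩ ∈ K ∨ F ⟨w, y⟩ ∈ K) → |f (F ⟨0, y⟩) - f (F ⟨w, y⟩)| ≤ ε) ?_ ?_ ?_ ?_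
  · exact ⟨1, one_pos, by simp⟩
  · rintro s t hst ⟨δ, hδ, H⟩
    exact ⟨δ, hδ, fun w h F hF hw y hy hm => H w h F hF hw y hy
      (hm.imp (fun h => hst h) (fun h => hst h))⟩
  · rintro s t ⟨δ, hδ, H⟩ ⟨δ', hδ', H'⟩
    refine ⟨min δ δ', lt_min hδ hδ', fun w h F hF hw y hy hm => ?_⟩
    have h1 := H w h F hF (hw.trans (min_le_left _ _)) y hy
    have h2 := H' w h F hF (hw.trans (min_le_right _ _)) y hy
    rcases hm with (hm | hm) | (hm | hm)
    exacts [h1 (Or.inl hm), h2 (Or.inl hm), h1 (Or.inr hm), h2 (Or.inr hm)]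
  intro x hx
  have hV : f ⁻¹' Metric.ball (f x) (ε / 2) ∈ 𝓝 x :=
    f.continuous.continuousAt.preimage_mem_nhds (Metric.ball_mem_nhds _ (half_pos hε))
  obtain ⟨e, he, hxe, r, hr, -, hrt, hrV⟩ := S.exists_ball_subset_target (hKz x hx) hV one_pos
  refine ⟨_, mem_nhdsWithin_of_mem_nhds (preimage_ball_mem_nhds hxe (half_pos hr)), r / 4,
    by positivity, fun w h F hF hw y hy hm => ?_⟩
  -- From the half ball, a displacement shorter than `r / 2` stays in the ball of radius `r`, where
  -- `f` is within `ε / 2` of `f x`. Either side may be the one known to meet the half ball.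
  have main : ∀ z ∈ Set.Icc 0 w ×ℂ Set.Ioo 0 h, ∀ z' ∈ Set.Icc 0 w ×ℂ Set.Ioo 0 h,
      ‖z' - z‖ < r / 2 → F z ∈ e.source ∩ e ⁻¹' Metric.ball (e x) (r / 2) →
      |f (F z) - f (F z')| ≤ ε := by
    intro z hz z' hz' hzz hFz
    have h0 : e (F z) ∈ Metric.ball (e x) r :=
      Metric.ball_subset_ball (half_le_self hr.le) hFz.2
    have h1 : e (F z) + (z' - z) ∈ Metric.ball (e x) r := by
      have h2 := hFz.2
      rw [Set.mem_preimage, mem_ball_iff_norm] at h2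
      rw [mem_ball_iff_norm, add_sub_right_comm]
      exact (norm_add_le _ _).trans_lt (by linarith)
    have h3 := hrV _ h0
    have h4 := hrV _ h1
    rw [← hF.apply_eq_of_mem_ball hz hz' he hFz.1 hrt h0 h1, Set.mem_preimage, Metric.mem_ball,
      Real.dist_eq] at h4
    rw [e.left_inv hFz.1, Set.mem_preimage, Metric.mem_ball, Real.dist_eq] at h3
    rw [abs_lt] at h3 h4
    rw [abs_le]
    constructor <;> linarith [h3.1, h3.2, h4.1, h4.2]
  have hw0 := hF.width_pos
  have hl : (⟨0, y⟩ : ℂ) ∈ Set.Icc 0 w ×ℂ Set.Ioo 0 h := ⟨⟨le_rfl, hw0.le⟩, hy⟩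
  have hr' : (⟨w, y⟩ : ℂ) ∈ Set.Icc 0 w ×ℂ Set.Ioo 0 h := ⟨⟨hw0.le, le_rfl⟩, hy⟩
  have hd : ‖(⟨w, y⟩ : ℂ) - ⟨0, y⟩‖ < r / 2 := by
    have : (⟨w, y⟩ : ℂ) - ⟨0, y⟩ = (w : ℂ) := by apply Complex.ext <;> simp
    rw [this, Complex.norm_real, Real.norm_of_nonneg hw0.le]
    linarith
  rcases hm with hm | hm
  · exact main _ hl _ hr' hd hm
  · rw [abs_sub_comm]
    exact main _ hr' _ hl (by rwa [norm_sub_rev]) hm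

/-- Where `|f| < ε / 2` on both sides there is nothing to prove; otherwise one side meets the
compact set `{ε / 2 ≤ |f|}`, which avoids the zeros. -/
theorem exists_width_abs_sub_le [CompactSpace X] [T2Space X] (S : TranslationSurface X)
    (f : C(X, ℝ)) (hf : ∀ x ∈ S.zeros, f x = 0) {ε : ℝ} (hε : 0 < ε) :
    ∃ δ > 0, ∀ (w h : ℝ) (F : ℂ → X), S.IsEmbeddedRectangle w h F → w ≤ δ → ∀ y ∈ Set.Ioo 0 h,
      |f (F ⟨0, y⟩) - f (F ⟨w, y⟩)| ≤ ε := by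
  have hK : IsCompact {x | ε / 2 ≤ |f x|} :=
    (isClosed_le continuous_const f.continuous.abs).isCompact
  obtain ⟨δ, hδ, H⟩ := S.exists_width_abs_sub_le_of_mem f hε hK (fun x hx hz => by
    have hx' : ε / 2 ≤ |f x| := hx
    rw [hf x hz, abs_zero] at hx'
    linarith)
  refine ⟨δ, hδ, fun w h F hF hw y hy => ?_⟩
  by_cases hm : ε / 2 ≤ |f (F ⟨0, y⟩)| ∨ ε / 2 ≤ |f (F ⟨w, y⟩)|
  · exact H w h F hF hw y hy hm
  · push Not at hm
    exact (abs_sub _ _).trans (by linarith [hm.1, hm.2])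

/-- A side of a wide embedded rectangle spends a bounded time in a compact set without zeros. -/
theorem exists_volume_side_mem_le [T2Space X] (S : TranslationSurface X)
    {δ : ℝ} (hδ : 0 < δ) {K : Set X} (hK : IsCompact K) (hKz : ∀ x ∈ K, x ∉ S.zeros) :
    ∃ C : NNReal, ∀ (w h : ℝ) (F : ℂ → X), S.IsEmbeddedRectangle w h F → δ ≤ w →
      volume {y | y ∈ Set.Icc δ (h - δ) ∧ F ⟨0, y⟩ ∈ K} ≤ C := by
  refine hK.induction_on (p := fun K => ∃ C : NNReal, ∀ (w h : ℝ) (F : ℂ → X),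
    S.IsEmbeddedRectangle w h F → δ ≤ w →
      volume {y | y ∈ Set.Icc δ (h - δ) ∧ F ⟨0, y⟩ ∈ K} ≤ C) ?_ ?_ ?_ ?_
  · exact ⟨0, by simp⟩
  · rintro s t hst ⟨C, H⟩
    refine ⟨C, fun w h F hF hw => (measure_mono ?_).trans (H w h F hF hw)⟩
    rintro y ⟨hy, hm⟩
    exact ⟨hy, hst hm⟩
  · rintro s t ⟨C, H⟩ ⟨C', H'⟩
    refine ⟨C + C', fun w h F hF hw => ?_⟩
    rw [ENNReal.coe_add]
    refine (measure_mono ?_).trans ((measure_union_le _ _).trans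
      (add_le_add (H w h F hF hw) (H' w h F hF hw)))
    rintro y ⟨hy, hm | hm⟩
    · exact Or.inl ⟨hy, hm⟩
    · exact Or.inr ⟨hy, hm⟩
  intro x hx
  obtain ⟨e, he, hxe, r, hr, hrδ, hrt, -⟩ :=
    S.exists_ball_subset_target (hKz x hx) univ_mem hδ
  refine ⟨_, mem_nhdsWithin_of_mem_nhds (preimage_ball_mem_nhds hxe (half_pos hr)), δ.toNNReal,
    fun w h F hF hw => (Real.volume_le_diam _).trans (Metric.ediam_le ?_)⟩
  -- Let the left side visit the half ball at `y₁` and `y₂`, with chart displacement `v`, so `‖v‖ <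
  -- r ≤ δ`. If `0 ≤ v.re`, moving by `v` from `⟨0, y₁⟩` stays in the rectangle, thanks to its width
  -- and the margin `δ` at its ends, and reaches the point `F ⟨0, y₂⟩`. Injectivity gives `y₂ - y₁ =
  -- v.im`. Hence the visits have diameter at most `δ`.
  have main : ∀ y₁ ∈ Set.Icc δ (h - δ), ∀ y₂ ∈ Set.Icc δ (h - δ),
      F ⟨0, y₁⟩ ∈ e.source ∩ e ⁻¹' Metric.ball (e x) (r / 2) →
      F ⟨0, y₂⟩ ∈ e.source ∩ e ⁻¹' Metric.ball (e x) (r / 2) →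
      0 ≤ (e (F ⟨0, y₂⟩) - e (F ⟨0, y₁⟩)).re → |y₁ - y₂| ≤ δ := by
    intro y₁ hy₁ y₂ hy₂ hm₁ hm₂ hre
    set v := e (F ⟨0, y₂⟩) - e (F ⟨0, y₁⟩) with hv
    have hvn : ‖v‖ < δ := by
      have h1 := hm₁.2
      have h2 := hm₂.2
      rw [Set.mem_preimage, Metric.mem_ball] at h1 h2
      rw [hv, ← dist_eq_norm]
      linarith [dist_triangle_right (e (F ⟨0, y₂⟩)) (e (F ⟨0, y₁⟩)) (e x)]
    have hvr := (le_abs_self _).trans ((Complex.abs_re_le_norm v).trans hvn.le)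
    have hvi := abs_lt.1 ((Complex.abs_im_le_norm v).trans_lt hvn)
    have hz₁ : (⟨0, y₁⟩ : ℂ) ∈ Set.Icc 0 w ×ℂ Set.Ioo 0 h :=
      ⟨⟨le_rfl, by linarith⟩, by simp only [Set.mem_preimage, Set.mem_Ioo]; constructor <;>
        linarith [hy₁.1, hy₁.2]⟩
    have hz₂ : (⟨0, y₂⟩ : ℂ) ∈ Set.Icc 0 w ×ℂ Set.Ioo 0 h :=
      ⟨⟨le_rfl, by linarith⟩, by simp only [Set.mem_preimage, Set.mem_Ioo]; constructor <;>
        linarith [hy₂.1, hy₂.2]⟩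
    have hz : (⟨0, y₁⟩ + v : ℂ) ∈ Set.Icc 0 w ×ℂ Set.Ioo 0 h := by
      refine ⟨?_, ?_⟩
      · simp only [Set.mem_preimage, Complex.add_re, zero_add]
        exact ⟨hre, by linarith⟩
      · simp only [Set.mem_preimage, Complex.add_im]
        constructor <;> linarith [hy₁.1, hy₁.2, hvi.1, hvi.2]
    have hsum : e (F ⟨0, y₁⟩) + ((⟨0, y₁⟩ + v : ℂ) - ⟨0, y₁⟩) = e (F ⟨0, y₂⟩) := by
      rw [hv]; ring
    have hball := Metric.ball_subset_ball (x := e x) (half_le_self hr.le)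
    have h1 := hF.apply_eq_of_mem_ball hz₁ hz he hm₁.1 hrt (hball hm₁.2)
      (by rw [hsum]; exact hball hm₂.2)
    rw [hsum, e.left_inv hm₂.1] at h1
    have hsub : Set.Icc 0 w ×ℂ Set.Ioo 0 h ⊆ Set.Icc 0 w ×ℂ Set.Icc 0 h := fun z hz =>
      ⟨hz.1, Set.Ioo_subset_Icc_self hz.2⟩
    have h2 := congrArg Complex.im (hF.injOn (hsub hz) (hsub hz₂) h1)
    simp only [Complex.add_im] at h2
    rw [abs_le]
    constructor <;> linarith [hvi.1, hvi.2]
  rintro y₁ ⟨hy₁, hm₁⟩ y₂ ⟨hy₂, hm₂⟩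
  rw [edist_dist, Real.dist_eq]
  refine ENNReal.ofReal_le_ofReal ?_
  -- If the displacement points left, out of the rectangle, the two visits exchange roles.
  rcases le_total 0 (e (F ⟨0, y₂⟩) - e (F ⟨0, y₁⟩)).re with hre | hre
  · exact main y₁ hy₁ y₂ hy₂ hm₁ hm₂ hre
  · rw [abs_sub_comm]
    refine main y₂ hy₂ y₁ hy₁ hm₂ hm₁ ?_
    rw [← neg_sub, Complex.neg_re]
    linarith

end TranslationSurface

/-! ### Cutoffs at the zeros and determination of measures -/

theorem integral_le_add_volume_superlevel {u : ℝ → ℝ} (hu : Continuous u) (h1 : ∀ y, u y ≤ 1)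
    {h c : ℝ} (hh : 0 ≤ h) (hc : 0 ≤ c) :
    ∫ y in (0 : ℝ)..h, u y ≤ c * h + (volume {y | y ∈ Set.Icc 0 h ∧ c ≤ u y}).toReal := by
  set T : Set ℝ := {y | y ∈ Set.Icc 0 h ∧ c ≤ u y} with hT
  have hTm : MeasurableSet T :=
    measurableSet_Icc.inter (isClosed_le continuous_const hu).measurableSet
  have hTs : T ⊆ Set.Icc 0 h := fun y hy => hy.1
  have hTf : volume T ≠ ⊤ := (measure_mono hTs).trans_lt measure_Icc_lt_top |>.ne
  have hi : Integrable (T.indicator fun _ => (1 : ℝ)) volume :=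
    (integrable_indicator_iff hTm).2 (integrableOn_const hTf)
  rw [intervalIntegral.integral_of_le hh, ← integral_Icc_eq_integral_Ioc]
  calc ∫ y in Set.Icc 0 h, u y ≤ ∫ y in Set.Icc 0 h, (c + T.indicator (fun _ => (1 : ℝ)) y) := by
        refine setIntegral_mono_on (hu.integrableOn_Icc)
          ((continuous_const.integrableOn_Icc).add hi.integrableOn) measurableSet_Icc ?_
        intro y hy
        by_cases hyT : y ∈ T
        · rw [Set.indicator_of_mem hyT]; linarith [h1 y]
        · rw [Set.indicator_of_notMem hyT, add_zero]
          by_contra hcon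
          exact hyT ⟨hy, (not_le.1 hcon).le⟩
    _ = _ := by
        rw [integral_add continuous_const.integrableOn_Icc hi.integrableOn,
          setIntegral_indicator hTm, Set.inter_eq_right.2 hTs]
        simp [hh, measureReal_def, mul_comm]

namespace TranslationSurface

variable {X : Type*} [TopologicalSpace X]

/-- The cone coordinates at the zeros complete the charts to a cover of `X`, so compactness gives
second countability. -/
theorem metrizableSpace [CompactSpace X] [T2Space X] (S : TranslationSurface X) :
    TopologicalSpace.MetrizableSpace X := by
  have h : ∀ x : X, ∃ e : OpenPartialHomeomorph X ℂ, x ∈ e.source := by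
    intro x
    by_cases hx : x ∈ S.zeros
    · obtain ⟨k, -, φ, hφ, -⟩ := S.cone x hx
      exact ⟨φ, hφ⟩
    · obtain ⟨e, -, he⟩ := S.covers x hx
      exact ⟨e, he⟩
  choose c hc using h
  let : ChartedSpace ℂ X :=
    { atlas := Set.univ
      chartAt := c
      mem_chart_source := hc
      chart_mem_atlas := fun _ => Set.mem_univ _ }
  have := ChartedSpace.secondCountable_of_sigmaCompact ℂ X
  exact TopologicalSpace.metrizableSpace_of_t3_secondCountable X

theorem IsInvariant.measure_zeros [MeasurableSpace X] {S : TranslationSurface X} {μ : Measure X}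
    (h : S.IsInvariant μ) : μ S.zeros = 0 := by
  rw [measure_eq_zero_iff_ae_notMem]
  filter_upwards [h.1] with x hx
  obtain ⟨γ, hγ, rfl⟩ := hx
  exact (hγ 0 (Set.mem_univ _)).1

/-- Continuous cutoff functions that vanish on a closed null set and tend to `1` off it. -/
theorem exists_cutoff_seq [CompactSpace X] [TopologicalSpace.MetrizableSpace X]
    {Z : Set X} (hZ : IsClosed Z) : ∃ g : ℕ → C(X, ℝ), (∀ n, ∀ x ∈ Z, g n x = 0) ∧
      (∀ n x, 0 ≤ g n x) ∧ (∀ n x, g n x ≤ 1) ∧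
      ∀ x ∉ Z, Tendsto (fun n => g n x) atTop (𝓝 1) := by
  refine ⟨fun n => ⟨fun x => 1 - (hZ.apprSeq n x : ℝ), by fun_prop⟩, fun n x hx => ?_,
    fun n x => ?_, fun n x => ?_, fun x hx => ?_⟩
  · simp [HasOuterApproxClosed.apprSeq_apply_eq_one hZ n hx]
  · have : (hZ.apprSeq n x : ℝ) ≤ 1 := by
      exact_mod_cast HasOuterApproxClosed.apprSeq_apply_le_one hZ n x
    simpa using this
  · simp
  · have h := (tendsto_pi_nhds.1 (HasOuterApproxClosed.tendsto_apprSeq hZ)) x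
    rw [Set.indicator_of_notMem hx] at h
    have h' : Tendsto (fun n => 1 - (hZ.apprSeq n x : ℝ)) atTop (𝓝 (1 - ((0 : NNReal) : ℝ))) :=
      tendsto_const_nhds.sub ((NNReal.continuous_coe.tendsto _).comp h)
    simpa using h'

theorem tendsto_integral_mul_cutoff [CompactSpace X] [MeasurableSpace X] [BorelSpace X]
    [TopologicalSpace.MetrizableSpace X] {Z : Set X} {g : ℕ → C(X, ℝ)}
    (h0 : ∀ n x, 0 ≤ g n x) (h1 : ∀ n x, g n x ≤ 1)
    (hg : ∀ x ∉ Z, Tendsto (fun n => g n x) atTop (𝓝 1)) (μ : Measure X) [IsFiniteMeasure μ]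
    (hμ : μ Z = 0) (f : C(X, ℝ)) :
    Tendsto (fun n => ∫ x, (f * g n) x ∂μ) atTop (𝓝 (∫ x, f x ∂μ)) := by
  have hfi : Integrable (fun x => ‖f x‖) μ :=
    ((BoundedContinuousFunction.mkOfCompact f).integrable μ).norm
  refine tendsto_integral_of_dominated_convergence (fun x => ‖f x‖)
    (fun n => (f * g n).continuous.aestronglyMeasurable) hfi (fun n => ae_of_all _ fun x => ?_) ?_
  · rw [ContinuousMap.mul_apply, norm_mul, Real.norm_of_nonneg (h0 n x)]
    exact mul_le_of_le_one_right (norm_nonneg _) (h1 n x)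
  · filter_upwards [measure_eq_zero_iff_ae_notMem.1 hμ] with x hx
    simpa using (hg x hx).const_mul (f x)

/-- Two finite measures that do not charge the zeros and agree on the continuous functions
vanishing at the zeros are equal. -/
theorem measure_ext [CompactSpace X] [T2Space X] [MeasurableSpace X] [BorelSpace X]
    (S : TranslationSurface X) {μ μ' : Measure X} [IsFiniteMeasure μ] [IsFiniteMeasure μ']
    (hμ : μ S.zeros = 0) (hμ' : μ' S.zeros = 0)
    (h : ∀ f : C(X, ℝ), (∀ x ∈ S.zeros, f x = 0) → ∫ x, f x ∂μ = ∫ x, f x ∂μ') : μ = μ' := by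
  have := S.metrizableSpace
  obtain ⟨g, hgz, h0, h1, hg⟩ := exists_cutoff_seq S.finite_zeros.isClosed
  refine ext_of_forall_integral_eq_of_IsFiniteMeasure fun f => ?_
  -- The hypothesis applies to each `f * g n`, which vanishes at the zeros; dominated convergence
  -- passes to `f`.
  have t1 := tendsto_integral_mul_cutoff h0 h1 hg μ hμ f.toContinuousMap
  have t2 := tendsto_integral_mul_cutoff h0 h1 hg μ' hμ' f.toContinuousMap
  refine tendsto_nhds_unique t1 (t2.congr fun n => (h _ fun x hx => ?_).symm)
  simp [hgz n x hx]

/-! ### Tall rectangles bounded by generic lines -/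

/-- `γ` is a complete vertical line along which two-sided averages converge to `μ`. -/
structure IsGenericLine [MeasurableSpace X] (S : TranslationSurface X) (μ : Measure X)
    (γ : ℝ → X) : Prop where
  isVertical : S.IsVertical Set.univ γ
  tendsto_average : ∀ f : C(X, ℝ),
    Tendsto (fun q : ℝ × ℝ => (1 / (q.1 + q.2)) * ∫ t in (-q.1)..q.2, f (γ t))
      (atTop ×ˢ atTop) (𝓝 (∫ x, f x ∂μ))

theorem IsGenericLine.continuous [MeasurableSpace X] {S : TranslationSurface X} {μ : Measure X}
    {γ : ℝ → X} (hγ : S.IsGenericLine μ γ) : Continuous γ :=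
  continuousOn_univ.1 hγ.isVertical.continuousOn

theorem IsGenericLine.exists_window [MeasurableSpace X] {S : TranslationSurface X} {μ : Measure X}
    {γ : ℝ → X} (hγ : S.IsGenericLine μ γ) (f : C(X, ℝ)) {ε M : ℝ} (hε : 0 < ε) (hM : 0 ≤ M) :
    ∃ R, ∀ H a : ℝ, R ≤ H → |a| ≤ M * H →
      |(∫ y in (0 : ℝ)..H, f (γ (a + y))) - H * ∫ x, f x ∂μ| ≤ ε * H :=
  exists_abs_integral_window_sub_le (f.continuous.comp hγ.continuous) (hγ.tendsto_average f) hε hM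

/-- Tall embedded rectangles whose left side lies on a generic line are thin. -/
theorem IsGenericLine.exists_width_le [CompactSpace X] [T2Space X] [MeasurableSpace X]
    [BorelSpace X] {S : TranslationSurface X} {μ : Measure X} [IsProbabilityMeasure μ]
    (hμ : μ S.zeros = 0) {γ : ℝ → X} (hγ : S.IsGenericLine μ γ) {δ M : ℝ} (hδ : 0 < δ)
    (hM : 0 ≤ M) :
    ∃ R, ∀ (w h : ℝ) (F : ℂ → X) (a : ℝ), S.IsEmbeddedRectangle w h F → R ≤ h → |a| ≤ M * h →
      (∀ y ∈ Set.Icc 0 h, F ⟨0, y⟩ = γ (a + y)) → w ≤ δ := by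
  have := S.metrizableSpace
  obtain ⟨g, hgz, h0, h1, hg⟩ := exists_cutoff_seq S.finite_zeros.isClosed
  have t1 := tendsto_integral_mul_cutoff h0 h1 hg μ hμ 1
  simp only [one_mul, ContinuousMap.one_apply, integral_const, probReal_univ, smul_eq_mul,
    mul_one] at t1
  obtain ⟨n, hn⟩ := (t1.eventually (lt_mem_nhds (show (1 / 2 : ℝ) < 1 by norm_num))).exists
  have hK : IsCompact {x | 1 / 4 ≤ g n x} :=
    (isClosed_le continuous_const (g n).continuous).isCompact
  obtain ⟨C, hC⟩ := S.exists_volume_side_mem_le hδ hK (fun x hx hz => by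
    have hx' : 1 / 4 ≤ g n x := hx
    rw [hgz n x hz] at hx'
    norm_num at hx')
  obtain ⟨R, hR⟩ := hγ.exists_window (g n) (show (0 : ℝ) < 1 / 8 by norm_num) hM
  -- The side integral of `g n` is at least `(1/2 - 1/8) * h` by genericity. If `w > δ`, it is at
  -- most `h / 4 + 2 * δ + C`, with `2 * δ` for the two ends and `C` for the visits to `K`. So `h /
  -- 8 ≤ 2 * δ + C`.
  refine ⟨max R (8 * (2 * δ + C) + 1), fun w h F a hF hRh ha hside => ?_⟩
  by_contra! hw
  have hh : 0 < h := hF.height_pos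
  have e1 := hR h a ((le_max_left _ _).trans hRh) ha
  have e2 : 8 * (2 * δ + C) + 1 ≤ h := (le_max_right _ _).trans hRh
  have e3 := integral_le_add_volume_superlevel (u := fun y => g n (γ (a + y)))
    ((g n).continuous.comp (hγ.continuous.comp (continuous_const.add continuous_id)))
    (fun y => h1 n _) hh.le (show (0 : ℝ) ≤ 1 / 4 by norm_num)
  have e4 : (volume {y | y ∈ Set.Icc 0 h ∧ 1 / 4 ≤ g n (γ (a + y))}).toReal ≤ 2 * δ + C := by
    refine ENNReal.toReal_le_of_le_ofReal (by positivity) ?_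
    have hsub : {y | y ∈ Set.Icc 0 h ∧ 1 / 4 ≤ g n (γ (a + y))} ⊆
        (Set.Icc 0 δ ∪ Set.Icc (h - δ) h) ∪
          {y | y ∈ Set.Icc δ (h - δ) ∧ F ⟨0, y⟩ ∈ {x | 1 / 4 ≤ g n x}} := by
      rintro y ⟨hy, hgy⟩
      rcases le_total y δ with h | h
      · exact Or.inl (Or.inl ⟨hy.1, h⟩)
      rcases le_total (_ - δ) y with h' | h'
      · exact Or.inl (Or.inr ⟨h', hy.2⟩)
      · refine Or.inr ⟨⟨h, h'⟩, ?_⟩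
        rw [hside y hy]
        exact hgy
    refine (measure_mono hsub).trans ((measure_union_le _ _).trans ?_)
    rw [ENNReal.ofReal_add (by positivity) (by positivity), ENNReal.ofReal_coe_nnreal]
    refine add_le_add ((measure_union_le _ _).trans ?_) (hC w h F hF hw.le)
    rw [Real.volume_Icc, Real.volume_Icc, two_mul, ENNReal.ofReal_add hδ.le hδ.le]
    simp
  rw [abs_le] at e1
  have e5 : h * (1 / 2) ≤ h * ∫ x, g n x ∂μ := by gcongr
  linarith [e1.1]

/-- Tall embedded rectangles spanned by generic lines of two measures force their integrals to be
close. -/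
theorem IsGenericLine.exists_abs_integral_sub_le [CompactSpace X] [T2Space X] [MeasurableSpace X]
    [BorelSpace X] {S : TranslationSurface X} {μ μ' : Measure X} [IsProbabilityMeasure μ]
    (hμ : μ S.zeros = 0) {γ γ' : ℝ → X} (hγ : S.IsGenericLine μ γ) (hγ' : S.IsGenericLine μ' γ')
    {f : C(X, ℝ)} (hf : ∀ x ∈ S.zeros, f x = 0) {ε M : ℝ} (hε : 0 < ε) (hM : 0 ≤ M) :
    ∃ R, ∀ (w h : ℝ) (F : ℂ → X) (a a' : ℝ), S.IsEmbeddedRectangle w h F → R ≤ h →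
      |a| ≤ M * h → |a'| ≤ M * h → (∀ y ∈ Set.Icc 0 h, F ⟨0, y⟩ = γ (a + y)) →
      (∀ y ∈ Set.Icc 0 h, F ⟨w, y⟩ = γ' (a' + y)) →
      |∫ x, f x ∂μ - ∫ x, f x ∂μ'| ≤ ε := by
  have hε3 : 0 < ε / 3 := by positivity
  obtain ⟨δ, hδ, H⟩ := S.exists_width_abs_sub_le f hf hε3
  obtain ⟨R₁, hR₁⟩ := hγ.exists_width_le hμ hδ hM
  obtain ⟨R₂, hR₂⟩ := hγ.exists_window f hε3 hM
  obtain ⟨R₃, hR₃⟩ := hγ'.exists_window f hε3 hM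
  refine ⟨max R₁ (max R₂ R₃), fun w h F a a' hF hR ha ha' hs hs' => ?_⟩
  simp only [max_le_iff] at hR
  have hh : 0 < h := hF.height_pos
  have hw := hR₁ w h F a hF hR.1 ha hs
  have e1 := hR₂ h a hR.2.1 ha
  have e2 := hR₃ h a' hR.2.2 ha'
  have hi : ∀ (c : ℝ) (γ : ℝ → X), Continuous γ →
      IntervalIntegrable (fun y => f (γ (c + y))) volume 0 h := fun c γ hc =>
    (f.continuous.comp (hc.comp (continuous_const.add continuous_id))).intervalIntegrable _ _
  have e3 : |(∫ y in (0 : ℝ)..h, f (γ (a + y))) - ∫ y in (0 : ℝ)..h, f (γ' (a' + y))| ≤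
      ε / 3 * h := by
    rw [← intervalIntegral.integral_sub (hi a γ hγ.continuous) (hi a' γ' hγ'.continuous)]
    have := intervalIntegral.norm_integral_le_of_norm_le_const_ae (a := 0) (b := h) (C := ε / 3)
      (f := fun y => f (γ (a + y)) - f (γ' (a' + y))) ?_
    · rwa [sub_zero, abs_of_pos hh, Real.norm_eq_abs] at this
    -- The top endpoint is discarded because a zero may lie on a horizontal side.
    · filter_upwards [Measure.ae_ne volume h] with y hyh hy
      rw [Set.uIoc_of_le hh.le] at hy
      rw [Real.norm_eq_abs, ← hs y ⟨hy.1.le, hy.2⟩, ← hs' y ⟨hy.1.le, hy.2⟩]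
      exact H w h F hF hw y ⟨hy.1, lt_of_le_of_ne hy.2 hyh⟩
  have e4 : h * |∫ x, f x ∂μ - ∫ x, f x ∂μ'| ≤ h * ε := by
    rw [← abs_of_pos hh, ← abs_mul, abs_of_pos hh]
    rw [abs_le] at e1 e2 e3 ⊢
    constructor <;> nlinarith only [e1.1, e1.2, e2.1, e2.2, e3.1, e3.2]
  exact le_of_mul_le_mul_left e4 hh

end TranslationSurface

/-! ### Pulling back from `g_t S` to `S` -/

namespace Teichmuller

theorem lin_injective (t : ℝ) : Function.Injective (lin t) :=
  (linHomeomorph t).injective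

theorem exp_mul_exp_neg (t : ℝ) : Real.exp (t / 2) * Real.exp (-t / 2) = 1 := by
  rw [← Real.exp_add, neg_div, add_neg_cancel, Real.exp_zero]

end Teichmuller

namespace TranslationSurface

open Teichmuller

variable {X : Type*} [TopologicalSpace X]

/-- A complete vertical line of `S`, traversed at speed `e^{t/2}`, is vertical for `g_t S`. -/
theorem IsVertical.teichmuller {S : TranslationSurface X} {γ : ℝ → X}
    (hγ : S.IsVertical Set.univ γ) (t s₀ : ℝ) :
    (S.teichmuller t).IsVertical Set.univ fun r => γ (Real.exp (t / 2) * (r - s₀)) := by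
  intro s _
  obtain ⟨hz, h⟩ := hγ (Real.exp (t / 2) * (s - s₀)) (Set.mem_univ _)
  refine ⟨hz, ?_⟩
  rintro _ ⟨e, he, rfl⟩ hs
  have h := h e he hs
  rw [nhdsWithin_univ] at h ⊢
  have hc : Continuous fun r : ℝ => Real.exp (t / 2) * (r - s₀) := by fun_prop
  filter_upwards [(hc.tendsto s).eventually h] with r hr
  refine ⟨hr.1, ?_⟩
  change lin t (e _) = lin t (e _) + _
  rw [hr.2, ← sub_eq_iff_eq_add', ← lin_sub, add_sub_cancel_left]
  have := exp_mul_exp_neg t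
  apply Complex.ext
  · simp [lin, -Complex.ofReal_sub, -Complex.ofReal_mul, -Complex.ofReal_exp]
  · simp only [lin, Complex.mul_im, Complex.ofReal_re, Complex.ofReal_im, Complex.I_re,
      Complex.I_im, mul_one, add_zero, mul_zero]
    linear_combination (r - s) * this

/-- The pull-back to `S` of an embedded rectangle of `g_t S`. -/
theorem IsEmbeddedRectangle.of_teichmuller {S : TranslationSurface X} {t w h : ℝ} {F : ℂ → X}
    (hF : (S.teichmuller t).IsEmbeddedRectangle w h F) :
    S.IsEmbeddedRectangle (Real.exp (-t / 2) * w) (Real.exp (t / 2) * h) (F ∘ lin t) := by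
  have ha := Real.exp_pos (t / 2)
  have hb := Real.exp_pos (-t / 2)
  have hab := exp_mul_exp_neg t
  have h1 : ∀ z ∈ Set.Icc 0 (Real.exp (-t / 2) * w), Real.exp (t / 2) * z ∈ Set.Icc 0 w := by
    intro z hz
    refine ⟨mul_nonneg ha.le hz.1, ?_⟩
    calc _ ≤ Real.exp (t / 2) * (Real.exp (-t / 2) * w) := by gcongr; exact hz.2
      _ = w := by rw [← mul_assoc, hab, one_mul]
  have h2 : ∀ z ∈ Set.Icc 0 (Real.exp (t / 2) * h), Real.exp (-t / 2) * z ∈ Set.Icc 0 h := by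
    intro z hz
    refine ⟨mul_nonneg hb.le hz.1, ?_⟩
    calc _ ≤ Real.exp (-t / 2) * (Real.exp (t / 2) * h) := by gcongr; exact hz.2
      _ = h := by rw [← mul_assoc, mul_comm (Real.exp _), hab, one_mul]
  have h3 : ∀ z ∈ Set.Ioo 0 (Real.exp (t / 2) * h), Real.exp (-t / 2) * z ∈ Set.Ioo 0 h := by
    intro z hz
    refine ⟨mul_pos hb hz.1, ?_⟩
    calc _ < Real.exp (-t / 2) * (Real.exp (t / 2) * h) := by gcongr; exact hz.2
      _ = h := by rw [← mul_assoc, mul_comm (Real.exp _), hab, one_mul]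
  have m1 : Set.MapsTo (lin t) (Set.Icc 0 (Real.exp (-t / 2) * w) ×ℂ
      Set.Icc 0 (Real.exp (t / 2) * h)) (Set.Icc 0 w ×ℂ Set.Icc 0 h) := fun z hz =>
    ⟨h1 _ hz.1, h2 _ hz.2⟩
  have m2 : Set.MapsTo (lin t) (Set.Icc 0 (Real.exp (-t / 2) * w) ×ℂ
      Set.Ioo 0 (Real.exp (t / 2) * h)) (Set.Icc 0 w ×ℂ Set.Ioo 0 h) := fun z hz =>
    ⟨h1 _ hz.1, h3 _ hz.2⟩
  refine ⟨mul_pos hb hF.width_pos, mul_pos ha hF.height_pos,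
    hF.continuousOn.comp (continuous_lin t).continuousOn m1,
    hF.injOn.comp (lin_injective t).injOn m1, fun z hz => hF.notMem_zeros _ (m2 hz), ?_⟩
  intro z hz e he hze
  have h := hF.translation _ (m2 hz) _ ⟨e, he, rfl⟩ hze
  have hl := (tendsto_nhdsWithin_iff.2 ⟨(continuous_lin t).continuousWithinAt (x := z),
    eventually_mem_nhdsWithin.mono m1⟩).eventually h
  filter_upwards [hl] with z' hz'
  change lin t (e (F (lin t z'))) = lin t (e (F (lin t z))) + (lin t z' - lin t z) at hz'
  rw [← sub_eq_iff_eq_add', ← lin_sub, ← lin_sub] at hz'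
  exact sub_eq_iff_eq_add'.1 (lin_injective t hz')

/-- A side of a rectangle of `g_t S` lying on a segment through `γ 0` lies, in `S`, on the line `γ`,
at a distance bounded by the length of the segment. -/
theorem IsSideOf.exists_eq_line [T2Space X] {S : TranslationSurface X} {t x x' h : ℝ} {F : ℂ → X}
    {β : (S.teichmuller t).VerticalSegment} (hs : IsSideOf F x h β)
    (hx : Real.exp (t / 2) * x' = x) {γ : ℝ → X} (hγ : S.IsVertical Set.univ γ)
    (hβ : γ 0 ∈ β.carrier) (hh : 0 ≤ h) :
    ∃ a, |a| ≤ Real.exp (t / 2) * β.length ∧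
      ∀ y ∈ Set.Icc 0 (Real.exp (t / 2) * h), (F ∘ lin t) ⟨x', y⟩ = γ (a + y) := by
  obtain ⟨s₀, hs₀, hs₀'⟩ := hβ
  obtain ⟨a, ha, hal, hs⟩ := hs
  have ht := exp_mul_exp_neg t
  have hb := Real.exp_pos (-t / 2)
  -- The segment passes through `γ 0` at parameter `s₀`, so it is the orbit traversed at speed `exp
  -- (t / 2)`.
  have heq := β.isVertical.eqOn isPreconnected_Icc
    ((hγ.teichmuller t s₀).mono (Set.subset_univ _)) hs₀ (by simpa using hs₀')
  refine ⟨Real.exp (t / 2) * (a - s₀), ?_, fun y hy => ?_⟩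
  · rw [abs_mul, abs_of_pos (Real.exp_pos _)]
    gcongr
    rw [abs_le]
    constructor <;> linarith [hs₀.1, hs₀.2]
  · have hy' : Real.exp (-t / 2) * y ∈ Set.Icc 0 h := by
      refine ⟨mul_nonneg hb.le hy.1, ?_⟩
      calc _ ≤ Real.exp (-t / 2) * (Real.exp (t / 2) * h) := by gcongr; exact hy.2
        _ = h := by rw [← mul_assoc, mul_comm (Real.exp _), ht, one_mul]
    have h1 : lin t ⟨x', y⟩ = ⟨x, Real.exp (-t / 2) * y⟩ := by rw [lin, ← hx]
    rw [Function.comp_apply, h1, hs _ hy',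
      heq ⟨add_nonneg ha hy'.1, by linarith [hy'.2]⟩]
    simp only
    congr 1
    linear_combination y * ht

end TranslationSurface

/-! ### Conclusion -/

theorem mainTheorem5 {X : Type*} [TopologicalSpace X] [CompactSpace X] [T2Space X]
    [ConnectedSpace X] [MeasurableSpace X] [BorelSpace X]
    (S : TranslationSurface X) (hmin : S.IsMinimal)
    (μ μ' : Measure X) [IsProbabilityMeasure μ] [IsProbabilityMeasure μ']
    (hμ : S.IsInvariant μ) (hμ' : S.IsInvariant μ') (hne : μ ≠ μ')
    (p p' : X) (hp : S.IsGenericPoint μ p) (hp' : S.IsGenericPoint μ' p')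
    (t : ℕ → ℝ) (ht : Tendsto t atTop atTop)
    (β β' : ∀ n : ℕ, (S.teichmuller (t n)).VerticalSegment)
    (hlen : ∀ n, (β n).length = (β' n).length)
    (hβ : ∀ n, p ∈ (β n).carrier) (hβ' : ∀ n, p' ∈ (β' n).carrier)
    (hlong : Tendsto (fun n => Real.exp (t n / 2) * (β n).length) atTop atTop)
    (η : ℕ → ℝ) (hη : ∀ n, 0 < η n ∧ η n ≤ 1)
    (hint : ∀ n, (S.teichmuller (t n)).Interact (η n) (β n) (β' n)) :
    Tendsto η atTop (𝓝 0) := by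
  obtain ⟨γ, hγv, rfl, hγ⟩ := hp
  obtain ⟨γ', hγv', rfl, hγ'⟩ := hp'
  have hγ : S.IsGenericLine μ γ := ⟨hγv, hγ⟩
  have hγ' : S.IsGenericLine μ' γ' := ⟨hγv', hγ'⟩
  have h0 := hμ.measure_zeros
  have h0' := hμ'.measure_zeros
  by_contra hcon
  obtain ⟨c, hc, hfreq⟩ : ∃ c > 0, ∃ᶠ n in atTop, c ≤ η n := by
    rw [Metric.tendsto_nhds] at hcon
    push Not at hcon
    obtain ⟨c, hc, h⟩ := hcon
    refine ⟨c, hc, h.mono fun n hn => ?_⟩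
    rwa [Real.dist_0_eq_abs, abs_of_pos (hη n).1] at hn
  -- Window starts are bounded by `exp (t n / 2) * |β|`, which is at most `1 / c` times the
  -- pulled-back height.
  have hM : 0 ≤ 1 / c := by positivity
  refine hne (S.measure_ext h0 h0' fun f hf => ?_)
  refine eq_of_abs_sub_nonpos (le_of_forall_pos_le_add fun ε hε => ?_)
  rw [zero_add]
  obtain ⟨R, hR⟩ := hγ.exists_abs_integral_sub_le h0 hγ' hf hε hM
  -- The second bound serves rectangles whose left side lies on the orbit of `p'`.
  obtain ⟨R', hR'⟩ := hγ'.exists_abs_integral_sub_le h0' hγ hf hε hM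
  obtain ⟨n, hcn, hn⟩ := (hfreq.and_eventually
    (hlong.eventually_ge_atTop (max R R' / c))).exists
  obtain ⟨-, w, h, F, hF, hh, hside⟩ := hint n
  have hF' := hF.of_teichmuller
  have hexp := Real.exp_pos (t n / 2)
  have hL : c * (Real.exp (t n / 2) * (β n).length) ≤ Real.exp (t n / 2) * h := by
    calc _ = Real.exp (t n / 2) * (c * (β n).length) := by ring
      _ ≤ Real.exp (t n / 2) * (η n * (β n).length) := by
        have := (β n).length_pos
        gcongr
      _ ≤ _ := by gcongr
  have hRh : max R R' ≤ Real.exp (t n / 2) * h := by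
    rw [div_le_iff₀' hc] at hn
    exact hn.trans hL
  have hMa : Real.exp (t n / 2) * (β n).length ≤ 1 / c * (Real.exp (t n / 2) * h) := by
    rw [one_div, ← div_eq_inv_mul, le_div_iff₀' hc]
    exact hL
  have hx : Real.exp (t n / 2) * (Real.exp (-t n / 2) * w) = w := by
    rw [← mul_assoc, Teichmuller.exp_mul_exp_neg, one_mul]
  have hhpos := hF.height_pos.le
  rcases hside with ⟨hs, hs'⟩ | ⟨hs', hs⟩
  · obtain ⟨a, ha, hs⟩ := hs.exists_eq_line (mul_zero _) hγv (hβ n) hhpos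
    obtain ⟨a', ha', hs'⟩ := hs'.exists_eq_line hx hγv' (hβ' n) hhpos
    rw [← hlen n] at ha'
    exact hR _ _ _ a a' hF' ((le_max_left _ _).trans hRh) (ha.trans hMa) (ha'.trans hMa) hs hs'
  · obtain ⟨a, ha, hs⟩ := hs.exists_eq_line hx hγv (hβ n) hhpos
    obtain ⟨a', ha', hs'⟩ := hs'.exists_eq_line (mul_zero _) hγv' (hβ' n) hhpos
    rw [← hlen n] at ha'
    rw [abs_sub_comm]
    exact hR' _ _ _ a' a hF' ((le_max_right _ _).trans hRh) (ha'.trans hMa) (ha.trans hMa) hs' hs
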